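/- **Setting.** A *crystal framework* $\mathcal C=(G,p)$ in $\mathbb R^d$ is a countable simple graph $G=(V,E)$ with $V\neq\emptyset$, together with an injective map $p:V\to\mathbb R^d$ (the joints), which admits a *periodic structure*: linearly independent vectors $a_1,\dots,a_d\in\mathbb R^d$ such that, with $a(k)=k_1a_1+\dots+k_da_d$, the translations by $a(k)$, $k\in\mathbb Z^d$, map joints to joints and bars to bars, with finitely many translation classes of joints and of bars. For $\mathbb K=\mathbb R$ or $\mathbb C$ let $\mathcal F(\mathcal C;\mathbb K)$ be the space of first-order flexes, i.e. of functions $u:V\to\mathbb K^d$ with $(u(v)-u(w))\cdot(p(v)-p(w))=0$ for all $vw\in E$ (bilinear dot product), and let $\mathcal F_{\rm rig}(\mathcal C;\mathbb K)$ be the space of the rigid motion flexes $v\mapsto Bp(v)+b$, with $B\in M_d(\mathbb K)$ skew-symmetric and $b\in\mathbb K^d$. Fix a periodic structure and a *motif* for it: representatives $v_1,\dots,v_n$ of the translation classes of joints and $e_1,\dots,e_m$ of the translation classes of bars. Write $(v_i,k)$ for the vertex at $p(v_i)+a(k)$; functions on $V$ are thus identified with functions $\mathbb Z^d\to\mathbb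 C^{dn}$. Put $\mathbb C_*=\mathbb C\setminus\{0\}$, $\omega^k=\omega_1^{k_1}\cdots\omega_d^{k_d}$, $\underline 1=(1,\dots,1)$, and let $\mathbb C(z)$ be the ring of Laurent polynomials in $z_1,\dots,z_d$. For a motif bar $e=(v,k)(w,l)$ put $p(e)=p(v,k)-p(w,l)$. * The *exponential velocity fields* are the linear combinations of the fields $(v_i,k)\mapsto q(k)\,\omega^k\,\alpha_i$ with $\omega\in\mathbb C_*^d$, $q\in\mathbb C[z_1,\dots,z_d]$ and $\alpha_1,\dots,\alpha_n\in\mathbb C^d$; $\mathcal F_{\rm exp}(\mathcal C;\mathbb C)$ is the space of those that are flexes. * A *factor-periodic flex* is a $u\in\mathcal F(\mathcal C;\mathbb C)$ with $u(v,k)=\omega^k u(v,0)$ for all $v,k$, for some $\omega\in\mathbb C_*^d$. A *flexible lattice periodic flex* is a $u\in\mathcal F(\mathcal C;\mathbb C)$ with $u(v,k)=u(v,0)+Xk$ for all $v,k$, for some $X\in M_d(\mathbb C)$. * The *transfer function* $\Psi_{\mathcal C}(z)$ is the $m\times dn$ matrix over $\mathbb C(z)$ whose row for $e=(v,k)(w,l)$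 has $p(e)z^{-k}$ in the columns of $v$ and $-p(e)z^{-l}$ in the columns of $w$ (these are added if $v=w$), and $0$ elsewhere. $R_{\rm fper}(\mathcal C)$ is the $m\times(dn+d^2)$ matrix whose row for $e$ is the row of $\Psi_{\mathcal C}(\underline 1)$ followed by $(l_1-k_1)p(e),\dots,(l_d-k_d)p(e)$. * $M(\mathcal C)$ is the $\mathbb C(z)$-submodule of $\mathbb C(z)\otimes\mathbb C^{dn}$ generated by the rows of $\Psi_{\mathcal C}(z)$. $M_{\rm rig}(\mathcal C)$ is the annihilator of $\mathcal F_{\rm rig}(\mathcal C;\mathbb C)$ in $\mathbb C(z)\otimes\mathbb C^{dn}$ for the bilinear pairing determined coordinatewise by $\langle z^k,u\rangle=u(-k)$. **Theorem.** Let $\mathcal C$ be a crystal framework in $\mathbb R^d$. For every periodic structure and every motif for it, the following are equivalent. (i) $\mathcal C$ is first-order rigid: $\mathcal F(\mathcal C;\mathbb R)=\mathcal F_{\rm rig}(\mathcal C;\mathbb R)$. (ii) $\mathcal C$ is exponentially rigid: $\mathcal F_{\rm exp}(\mathcal C;\mathbb C)=\mathcal F_{\rm rig}(\mathcal C;\mathbb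 C)$. (iii) There are no nontrivial factor-periodic flexes and no nontrivial flexible lattice periodic flexes for the periodic structure: every factor-periodic flex lies in $\mathcal F_{\rm rig}(\mathcal C;\mathbb C)$, and the space of flexible lattice periodic flexes equals $\mathcal F_{\rm rig}(\mathcal C;\mathbb C)$. (iv) $\Psi_{\mathcal C}(z)$ and $R_{\rm fper}(\mathcal C)$ are rank extremal: $\operatorname{rank}\Psi_{\mathcal C}(\omega)=dn$ for all $\omega\in\mathbb C_*^d$ with $\omega\ne\underline 1$, $\operatorname{rank}\Psi_{\mathcal C}(\underline 1)=dn-d$, and $\operatorname{rank}R_{\rm fper}(\mathcal C)=dn+d(d-1)/2$. (v) $M(\mathcal C)=M_{\rm rig}(\mathcal C)$; or, what is also equivalent, $M(\mathcal C)$ and $M_{\rm rig}(\mathcal C)$ have the same intersection with $\mathbb C[z]\otimes\mathbb C^{dn}$. -/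

import Mathlib

universe u

noncomputable section

namespace Crystal

/-- A bar-joint framework `(G, p)` in `ℝ^d`. Only the dot product of `ℝ^d` is used below, never
a norm, so points of `ℝ^d` are plain coordinate vectors. -/
structure Framework (d : ℕ) where
  /-- the vertices, identified with the joints -/
  V : Type u
  /-- the simple graph of bars -/
  graph : SimpleGraph V
  /-- the placement of the joints -/
  p : V → Fin d → ℝ

/-- The lattice vector `a(k) = k₁ a₁ + ⋯ + k_d a_d`. -/
def latticeVec {d : ℕ} (a : Fin d → Fin d → ℝ) (k : Fin d → ℤ) : Fin d → ℝ :=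
  ∑ i, (k i : ℝ) • a i

/-- `v'` is the translate of `v` by `a(k)`. -/
def Framework.IsTranslate {d : ℕ} (C : Framework.{u} d) (a : Fin d → Fin d → ℝ)
    (k : Fin d → ℤ) (v v' : C.V) : Prop :=
  C.p v' = C.p v + latticeVec a k

/-- A periodic structure: `d` linearly independent vectors such that the translations by the
lattice that they generate map joints to joints and bars to bars, with finitely many translation
classes of joints and of bars. -/
structure PeriodicStructure {d : ℕ} (C : Framework.{u} d) where
  /-- the period vectors -/
  a : Fin d → Fin d → ℝ
  linearIndependent : LinearIndependent ℝ a
  joint_translate : ∀ (k : Fin d → ℤ) (v : C.V), ∃ v', C.IsTranslate a k v v'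
  bar_translate : ∀ (k : Fin d → ℤ) (v w v' w' : C.V), C.IsTranslate a k v v' →
    C.IsTranslate a k w w' → C.graph.Adj v w → C.graph.Adj v' w'
  finite_joints : ∃ F : Set C.V, F.Finite ∧ ∀ v, ∃ v₀ ∈ F, ∃ k, C.IsTranslate a k v₀ v
  finite_bars : ∃ F : Set (C.V × C.V), F.Finite ∧ ∀ v w, C.graph.Adj v w →
    ∃ e ∈ F, ∃ k, C.IsTranslate a k e.1 v ∧ C.IsTranslate a k e.2 w

/-- A crystal framework: a bar-joint framework with countably many (and at least one) joints at
distinct points that admits a periodic structure. -/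
structure CrystalFramework (d : ℕ) extends Framework.{u} d where
  countable : Countable V
  nonempty : Nonempty V
  injective : Function.Injective p
  periodic : Nonempty (PeriodicStructure toFramework)

/-- Velocity fields: `𝕜^d`-valued functions on the set of joints. -/
abbrev Framework.VelocityField {d : ℕ} (C : Framework.{u} d) (𝕜 : Type) : Type u :=
  C.V → Fin d → 𝕜

/-- The space `F(C; 𝕜)` of first-order flexes: `(u(v) - u(w)) · (p(v) - p(w)) = 0` for every
bar (the dot product is bilinear also when `𝕜 = ℂ`). -/
def Framework.flexSpace {d : ℕ} (C : Framework.{u} d) (𝕜 : Type) [RCLike 𝕜] :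
    Submodule 𝕜 (C.VelocityField 𝕜) where
  carrier := {u | ∀ v w, C.graph.Adj v w →
    ∑ j, (u v j - u w j) * ((C.p v j - C.p w j : ℝ) : 𝕜) = 0}
  zero_mem' := by
    intro v w _
    simp
  add_mem' := by
    intro x y hx hy v w h
    have h1 := hx v w h
    have h2 := hy v w h
    rw [← add_zero (0 : 𝕜)]
    nth_rewrite 1 [← h1]
    rw [← h2, ← Finset.sum_add_distrib]
    refine Finset.sum_congr rfl fun j _ => ?_
    simp only [Pi.add_apply]
    ring
  smul_mem' := by
    intro c x hx v w h
    have h1 := hx v w h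
    rw [← mul_zero c, ← h1, Finset.mul_sum]
    refine Finset.sum_congr rfl fun j _ => ?_
    simp only [Pi.smul_apply, smul_eq_mul]
    ring

/-- The space `F_rig(C; 𝕜)` of rigid motion flexes `v ↦ B p(v) + b`, with `B` a skew-symmetric
matrix and `b` a vector. -/
def Framework.rigidSpace {d : ℕ} (C : Framework.{u} d) (𝕜 : Type) [RCLike 𝕜] :
    Submodule 𝕜 (C.VelocityField 𝕜) where
  carrier := {u | ∃ B : Matrix (Fin d) (Fin d) 𝕜, B.transpose = -B ∧ ∃ b : Fin d → 𝕜,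
    ∀ v, u v = B.mulVec (fun j => (C.p v j : 𝕜)) + b}
  zero_mem' := ⟨0, by simp, 0, by simp⟩
  add_mem' := by
    rintro x y ⟨B, hB, b, h⟩ ⟨B', hB', b', h'⟩
    refine ⟨B + B', by rw [Matrix.transpose_add, hB, hB', neg_add], b + b', fun v => ?_⟩
    rw [Pi.add_apply, h v, h' v, Matrix.add_mulVec]
    abel
  smul_mem' := by
    rintro c x ⟨B, hB, b, h⟩
    refine ⟨c • B, by rw [Matrix.transpose_smul, hB, smul_neg], c • b, fun v => ?_⟩
    rw [Pi.smul_apply, h v, Matrix.smul_mulVec, smul_add]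

/-- First-order rigidity: `F(C; ℝ) = F_rig(C; ℝ)`. -/
def Framework.FirstOrderRigid {d : ℕ} (C : Framework.{u} d) : Prop :=
  C.flexSpace ℝ = C.rigidSpace ℝ

/-- The monomial function `ω ↦ ω^k = ω₁^{k₁} ⋯ ω_d^{k_d}` on `(ℂ \ {0})^d`. -/
def monom {d : ℕ} (ω : Fin d → ℂˣ) (k : Fin d → ℤ) : ℂ :=
  ((∏ j, ω j ^ k j : ℂˣ) : ℂ)

section PeriodicFlexes

variable {d : ℕ} {C : Framework.{u} d} (S : PeriodicStructure C)

/-- `u` is factor-periodic with multi-factor `ω`: a translation by `a(k)` multiplies the velocity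
by `ω^k`. -/
def PeriodicStructure.IsFactorPeriodic (ω : Fin d → ℂˣ) (u : C.VelocityField ℂ) : Prop :=
  ∀ (k : Fin d → ℤ) (v v' : C.V), C.IsTranslate S.a k v v' → u v' = monom ω k • u v

/-- The velocity fields that are periodic up to an affine correction: a translation by `a(k)`
adds the velocity `X k`, for some fixed matrix `X`. -/
def PeriodicStructure.IsAffinelyPeriodic (u : C.VelocityField ℂ) : Prop :=
  ∃ X : Matrix (Fin d) (Fin d) ℂ, ∀ (k : Fin d → ℤ) (v v' : C.V),
    C.IsTranslate S.a k v v' → u v' = u v + X.mulVec (fun j => (k j : ℂ))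

/-- There are no nontrivial factor-periodic flexes: each of them is a rigid motion flex. -/
def PeriodicStructure.NoFactorPeriodicFlex : Prop :=
  ∀ (ω : Fin d → ℂˣ) (u : C.VelocityField ℂ), u ∈ C.flexSpace ℂ → S.IsFactorPeriodic ω u →
    u ∈ C.rigidSpace ℂ

/-- Flexible lattice periodic rigidity: the space of the flexible lattice periodic flexes is the
space of rigid motion flexes. -/
def PeriodicStructure.FlexibleLatticeRigid : Prop :=
  {u | u ∈ C.flexSpace ℂ ∧ S.IsAffinelyPeriodic u} = (C.rigidSpace ℂ : Set (C.VelocityField ℂ))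

/-- A labelled motif for a periodic structure, with `n` motif joints and `m` motif bars. The vertex
`label (i, k)` is the translate by `a(k)` of the `i`-th motif joint `label (i, 0)`; that `label` is
a bijection says that every translation class of joints has exactly one representative in the
motif. The `e`-th motif bar joins the vertices labelled `tail e` and `head e`, and every bar is the
translate of exactly one motif bar. -/
structure Motif (n m : ℕ) where
  label : Fin n × (Fin d → ℤ) ≃ C.V
  label_translate : ∀ i k, C.IsTranslate S.a k (label (i, 0)) (label (i, k))
  tail : Fin m → Fin n × (Fin d → ℤ)
  head : Fin m → Fin n × (Fin d → ℤ)
  adj : ∀ e, C.graph.Adj (label (tail e)) (label (head e))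
  existsUnique_bar : ∀ v w, C.graph.Adj v w → ∃! ek : Fin m × (Fin d → ℤ),
    s(label ((tail ek.1).1, (tail ek.1).2 + ek.2), label ((head ek.1).1, (head ek.1).2 + ek.2)) =
      s(v, w)

end PeriodicFlexes

/-- The Laurent polynomial ring `ℂ(z)` in `z₁^{±1}, …, z_d^{±1}`. -/
abbrev Laurent (d : ℕ) : Type := AddMonoidAlgebra ℂ (Fin d → ℤ)

/-- The value of a Laurent polynomial at a point of `(ℂ \ {0})^d`. -/
def Laurent.eval {d : ℕ} (ω : Fin d → ℂˣ) (q : Laurent d) : ℂ :=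
  q.coeff.sum fun k c => c * monom ω k

namespace Motif

variable {d n m : ℕ} {C : Framework.{u} d} {S : PeriodicStructure C} (M : Motif S n m)

/-- The space of exponential velocity fields: the linear span of the fields
`e_{ω,q} ⊗ a : (i, k) ↦ q(k) ω^k a_i`, with `ω ∈ (ℂ \ {0})^d`, `q` a polynomial and `a` in
`(ℂ^d)^n`. -/
def expSpace : Submodule ℂ (C.VelocityField ℂ) :=
  Submodule.span ℂ {u | ∃ (ω : Fin d → ℂˣ) (q : MvPolynomial (Fin d) ℂ) (a : Fin n → Fin d → ℂ),
    ∀ i k, u (M.label (i, k)) =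
      (MvPolynomial.eval (fun j => (k j : ℂ)) q * monom ω k) • a i}

/-- Exponential rigidity: every flex among the exponential velocity fields is a rigid motion flex,
and conversely. -/
def ExponentiallyRigid : Prop :=
  M.expSpace ⊓ C.flexSpace ℂ = C.rigidSpace ℂ

/-- The bar vector `p(e) = p(v,k) - p(w,l)` of the motif bar `e = (v,k)(w,l)`. -/
def barVec (e : Fin m) (c : Fin d) : ℝ :=
  C.p (M.label (M.tail e)) c - C.p (M.label (M.head e)) c

/-- The transfer function `Ψ_C(z)`. The row of `e = (v,k)(w,l)` has the block `p(e) z^{-k}` in the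
columns of `v` and the block `-p(e) z^{-l}` in the columns of `w`; the two blocks add up to
`p(e) (z^{-k} - z^{-l})` when `v = w`. -/
def transfer : Matrix (Fin m) (Fin n × Fin d) (Laurent d) := fun e x =>
  (if x.1 = (M.tail e).1 then
    AddMonoidAlgebra.single (-(M.tail e).2) (M.barVec e x.2 : ℂ) else 0) -
  (if x.1 = (M.head e).1 then
    AddMonoidAlgebra.single (-(M.head e).2) (M.barVec e x.2 : ℂ) else 0)

/-- The complex matrix `Ψ_C(ω)`. -/
def transferAt (ω : Fin d → ℂˣ) : Matrix (Fin m) (Fin n × Fin d) ℂ :=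
  M.transfer.map (Laurent.eval ω)

/-- The flexible lattice periodic rigidity matrix `R_fper(C)`: the row of `e = (v,k)(w,l)` has
`p(e)` in the columns of `v` and `-p(e)` in the columns of `w` (these cancel when `v = w`), followed
by `(l₁ - k₁) p(e), …, (l_d - k_d) p(e)`. -/
def flexibleMatrix : Matrix (Fin m) (Fin n × Fin d ⊕ Fin d × Fin d) ℂ := fun e x =>
  match x with
  | Sum.inl y =>
    (if y.1 = (M.tail e).1 then (M.barVec e y.2 : ℂ) else 0) -
    (if y.1 = (M.head e).1 then (M.barVec e y.2 : ℂ) else 0)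
  | Sum.inr y => (((M.head e).2 y.1 - (M.tail e).2 y.1 : ℤ) : ℂ) * (M.barVec e y.2 : ℂ)

/-- The transfer function is rank extremal: `Ψ_C(ω)` has rank `dn` for every `ω ≠ (1, …, 1)`, and
`Ψ_C(1, …, 1)` has rank `dn - d`. -/
def TransferRankExtremal : Prop :=
  (∀ ω : Fin d → ℂˣ, ω ≠ 1 → (M.transferAt ω).rank = d * n) ∧
    (M.transferAt 1).rank + d = d * n

/-- `R_fper(C)` is rank extremal: its rank is `dn + d(d-1)/2`. -/
def FlexibleRankExtremal : Prop :=
  M.flexibleMatrix.rank = d * n + d * (d - 1) / 2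

/-- The `ℂ(z)`-module `M(C)` of the framework, generated by the rows of the transfer function. -/
def module : Submodule (Laurent d) (Fin n × Fin d → Laurent d) :=
  Submodule.span (Laurent d) (Set.range fun e => M.transfer e)

/-- The bilinear pairing of `ℂ(z) ⊗ ℂ^{dn}` with the velocity fields `u : ℤ^d → ℂ^{dn}` for which
`⟨z^k, u⟩ = u(-k)` in each coordinate, so that multiplication by `z_i` is dual to the forward shift
`(W_i u)(k) = u(k - e_i)`. -/
def pairing (q : Fin n × Fin d → Laurent d) (u : C.VelocityField ℂ) : ℂ :=
  ∑ x : Fin n × Fin d, (q x).coeff.sum fun k c => c * u (M.label (x.1, -k)) x.2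

/-- The rigidity module: the annihilator in `ℂ(z) ⊗ ℂ^{dn}` of the space of rigid motion
flexes. -/
def rigidityModule : Set (Fin n × Fin d → Laurent d) :=
  {q | ∀ u ∈ C.rigidSpace ℂ, M.pairing q u = 0}

end Motif

/-- The polynomial part `ℂ[z] ⊗ ℂ^{dn}` of `ℂ(z) ⊗ ℂ^{dn}`: no negative exponents occur. -/
def polynomialVectors (d n : ℕ) : Set (Fin n × Fin d → Laurent d) :=
  {q | ∀ x, ∀ k ∈ (q x).coeff.support, 0 ≤ k}

end Crystal

end

/-!
Let `F` and `F_rig` be the complex spaces of flexes and of rigid motion flexes. First-order rigidity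
is the equality `F = F_rig`, by taking real and imaginary parts. The pairing identifies the velocity
fields with the full algebraic dual of `ℂ(z) ⊗ ℂ^{dn}` (`Motif.toDual`), and `F` is the annihilator
of `M(C)` because multiplication by a monomial is dual to a translation (`Motif.mem_flexSpace_iff`).
As `F_rig` has finite dimension, it is the annihilator of its annihilator `M_rig(C)`; so
`M(C) = M_rig(C)` gives `F = F_rig`. Both modules are stable under all monomials, so they may be
compared in their polynomial parts.

First-order rigidity clearly gives exponential rigidity, and since the factor-periodic and the
flexible lattice periodic flexes are exponential fields, that in turn excludes nontrivial ones.

The return to `M(C) = M_rig(C)` is spectral synthesis (`Motif.module_eq_rigidityModule`). By the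
Krull intersection theorem and the Nullstellensatz, an element `q` outside `M(C)` stays outside
`M(C) + I^t (ℂ(z) ⊗ ℂ^{dn})` for the ideal `I` of some point `ω⁻¹` of `(ℂ \ {0})^d` and some `t`. So
`q` does not vanish on some flex `u` that is annihilated by `I^t`, and it remains to see that `u` is in
`F_rig` (`Motif.mem_rigidSpace_of_pairing_pow_ker`). This goes by induction on `t`, as the
differences `u(k + e_j) - ω_j u(k)` are annihilated by `I^{t-1}`. If `ω ≠ 1` they vanish by induction,
so `u` is factor-periodic, hence a rigid motion flex, hence zero. If `ω = 1` they are rigid motion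
flexes `B_j p + b_j`; since differences commute, `B_i a_j = B_j a_i`, and a trilinear form that is
symmetric in two and skew in two of its arguments is zero. Thus `B_j = 0`, and `u` is a flexible
lattice periodic flex.

Finally, the kernels of `Ψ(ω⁻¹)` and of `R_fper(C)` are the spaces of factor-periodic flexes with
multi-factor `ω` and of flexible lattice periodic flexes, so the rank conditions compare their
dimensions with those of the spaces of translations and of rigid motion flexes, which are `d` and
`d(d-1)/2 + d`.
-/

noncomputable section

namespace Crystal

/-! ### The lattice and its characters -/

section Lattice

variable {d : ℕ}

lemma latticeVec_add (a : Fin d → Fin d → ℝ) (k l : Fin d → ℤ) :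
    latticeVec a (k + l) = latticeVec a k + latticeVec a l := by
  simp [latticeVec, add_smul, Finset.sum_add_distrib]

@[simp] lemma latticeVec_zero (a : Fin d → Fin d → ℝ) : latticeVec a 0 = 0 := by
  simp [latticeVec]

@[simp] lemma latticeVec_single (a : Fin d → Fin d → ℝ) (j : Fin d) :
    latticeVec a (Pi.single j 1) = a j := by
  rw [latticeVec, Finset.sum_eq_single j] <;> simp +contextual

@[simp] lemma monom_zero (ω : Fin d → ℂˣ) : monom ω 0 = 1 := by simp [monom]

lemma monom_add (ω : Fin d → ℂˣ) (k l : Fin d → ℤ) :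
    monom ω (k + l) = monom ω k * monom ω l := by
  simp only [monom, Pi.add_apply, zpow_add, Finset.prod_mul_distrib, Units.val_mul]

@[simp] lemma monom_one (k : Fin d → ℤ) : monom (1 : Fin d → ℂˣ) k = 1 := by simp [monom]

lemma monom_inv_neg (ω : Fin d → ℂˣ) (k : Fin d → ℤ) : monom ω⁻¹ (-k) = monom ω k := by
  simp [monom]

@[simp] lemma monom_single (ω : Fin d → ℂˣ) (j : Fin d) :
    monom ω (Pi.single j 1) = ω j := by
  rw [monom, Finset.prod_eq_single j] <;> simp +contextual

lemma monom_ne_zero (ω : Fin d → ℂˣ) (k : Fin d → ℤ) : monom ω k ≠ 0 := Units.ne_zero _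

lemma eq_apply_zero_of_add_single {β : Type*} (g : (Fin d → ℤ) → β)
    (h : ∀ k j, g (k + Pi.single j 1) = g k) (k : Fin d → ℤ) : g k = g 0 := by
  let H : AddSubgroup (Fin d → ℤ) :=
    { carrier := {l | ∀ k, g (k + l) = g k}
      zero_mem' := by simp
      add_mem' := by
        intro x y hx hy k
        rw [← add_assoc, hy, hx]
      neg_mem' := by
        intro x hx k
        rw [← hx (k + -x), neg_add_cancel_right] }
  have hk : k ∈ H := by
    have : k = ∑ j, k j • (Pi.single j 1 : Fin d → ℤ) := by
      ext i
      simp [Finset.sum_apply, Pi.single_apply]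
    rw [this]
    exact sum_mem fun j _ => H.zsmul_mem (fun k => h k j) _
  simpa using hk 0

end Lattice

/-! ### Skew-symmetric matrices -/

section Skew

open Matrix

variable {d : ℕ}

lemma dotProduct_mulVec_swap_of_skew {𝕜 : Type*} [CommRing 𝕜] {B : Matrix (Fin d) (Fin d) 𝕜}
    (hB : Bᵀ = -B) (x y : Fin d → 𝕜) : (B *ᵥ x) ⬝ᵥ y = -((B *ᵥ y) ⬝ᵥ x) := by
  rw [dotProduct_comm, dotProduct_mulVec, ← mulVec_transpose, hB, neg_mulVec, neg_dotProduct]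

lemma mulVec_dotProduct_self_of_skew {𝕜 : Type*} [Field 𝕜] [CharZero 𝕜]
    {B : Matrix (Fin d) (Fin d) 𝕜} (hB : Bᵀ = -B) (x : Fin d → 𝕜) : (B *ᵥ x) ⬝ᵥ x = 0 :=
  self_eq_neg.mp (dotProduct_mulVec_swap_of_skew hB x x)

/-- A trilinear form that is symmetric in its first two and skew in its last two arguments
vanishes; here the form is `(x, y, z) ↦ B(x) y · z`, evaluated on the columns of `A`. -/
lemma eq_zero_of_skew_of_mulVec_comm {A : Matrix (Fin d) (Fin d) ℂ} (hA : IsUnit A.det)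
    {B : Fin d → Matrix (Fin d) (Fin d) ℂ} (hB : ∀ j, (B j)ᵀ = -B j)
    (hcomm : ∀ i j, B i *ᵥ A.col j = B j *ᵥ A.col i) (i : Fin d) : B i = 0 := by
  have hT : ∀ i j l, (B i *ᵥ A.col j) ⬝ᵥ A.col l = 0 := by
    intro i j l
    apply self_eq_neg.mp
    calc (B i *ᵥ A.col j) ⬝ᵥ A.col l = -((B i *ᵥ A.col l) ⬝ᵥ A.col j) :=
          dotProduct_mulVec_swap_of_skew (hB i) _ _
      _ = -((B l *ᵥ A.col i) ⬝ᵥ A.col j) := by rw [hcomm i l]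
      _ = (B l *ᵥ A.col j) ⬝ᵥ A.col i := by
          rw [dotProduct_mulVec_swap_of_skew (hB l), neg_neg]
      _ = (B j *ᵥ A.col l) ⬝ᵥ A.col i := by rw [hcomm l j]
      _ = -((B j *ᵥ A.col i) ⬝ᵥ A.col l) := dotProduct_mulVec_swap_of_skew (hB j) _ _
      _ = -((B i *ᵥ A.col j) ⬝ᵥ A.col l) := by rw [hcomm j i]
  have h : Aᵀ * B i * A = 0 := by
    ext l j
    have := hT i j l
    rw [dotProduct_comm] at this
    rw [Matrix.mul_assoc, mul_apply_eq_vecMul, Matrix.zero_apply]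
    simpa [dotProduct, Matrix.mul_apply, mulVec, vecMul] using this
  have hA' : IsUnit Aᵀ := by rw [Matrix.isUnit_iff_isUnit_det, det_transpose]; exact hA
  have hA'' : IsUnit A := by rwa [Matrix.isUnit_iff_isUnit_det]
  rw [hA''.mul_left_eq_zero, hA'.mul_right_eq_zero] at h
  exact h

/-- The space of skew-symmetric matrices. -/
def skewMatrices (d : ℕ) : Submodule ℂ (Matrix (Fin d) (Fin d) ℂ) where
  carrier := {B | Bᵀ = -B}
  zero_mem' := by simp
  add_mem' := by
    intro B B' hB hB'
    change Bᵀ = -B at hB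
    change B'ᵀ = -B' at hB'
    change (B + B')ᵀ = -(B + B')
    rw [transpose_add, hB, hB', neg_add]
  smul_mem' := by
    intro c B hB
    change Bᵀ = -B at hB
    change (c • B)ᵀ = -(c • B)
    rw [transpose_smul, hB, smul_neg]

/-- A skew-symmetric matrix is determined by its entries above the diagonal. -/
def skewMatricesEquiv (d : ℕ) :
    skewMatrices d ≃ₗ[ℂ] ({x : Fin d × Fin d // x.1 < x.2} → ℂ) where
  toFun B x := B.1 x.1.1 x.1.2
  map_add' _ _ := rfl
  map_smul' _ _ := rfl
  invFun f := ⟨Matrix.of fun i j => if h : i < j then f ⟨(i, j), h⟩ else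
      if h : j < i then -f ⟨(j, i), h⟩ else 0, by
    change _ = -_
    ext i j
    rcases lt_trichotomy i j with h | h | h
    · simp [h, h.not_gt]
    · simp [h]
    · simp [h, h.not_gt]⟩
  left_inv B := by
    ext i j
    have hB : ∀ i j, B.1 j i = -B.1 i j := fun i j => congrFun (congrFun B.2 i) j
    rcases lt_trichotomy i j with h | h | h
    · simp [h]
    · subst h
      simpa using (self_eq_neg.mp (hB i i)).symm
    · simp [h, h.not_gt, hB i j]
  right_inv f := by
    ext ⟨x, hx⟩
    simp [hx]

lemma finrank_skewMatrices (d : ℕ) : Module.finrank ℂ (skewMatrices d) = d * (d - 1) / 2 := by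
  rw [(skewMatricesEquiv d).finrank_eq, Module.finrank_fintype_fun_eq_card,
    Fintype.card_subtype]
  have h1 : ∀ j : Fin d, (Finset.univ.filter fun i : Fin d => i < j).card = j := by
    intro j
    rw [← Fin.card_Iio j]
    congr 1
    ext i
    simp
  have h2 : (Finset.univ.filter fun x : Fin d × Fin d => x.1 < x.2).card =
      ∑ j : Fin d, (Finset.univ.filter fun i : Fin d => i < j).card := by
    simp only [Finset.card_filter, Fintype.sum_prod_type_right]
  rw [h2, Finset.sum_congr rfl fun j _ => h1 j, Fin.sum_univ_eq_sum_range (fun i => i),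
    Finset.sum_range_id]

end Skew

/-! ### Complexified periods and rigid motion flexes -/

section Rigid

open Matrix

variable {d : ℕ} {C : Framework.{u} d} (S : PeriodicStructure C)

/-- The complex matrix whose columns are the period vectors. -/
def PeriodicStructure.periodMatrix : Matrix (Fin d) (Fin d) ℂ :=
  Matrix.of fun c j => (S.a j c : ℂ)

lemma PeriodicStructure.isUnit_det_periodMatrix : IsUnit S.periodMatrix.det := by
  have h : IsUnit (Matrix.of S.a) :=
    (Matrix.linearIndependent_rows_iff_isUnit (A := Matrix.of S.a)).mp S.linearIndependent
  have h2 : S.periodMatrix = ((Matrix.of S.a).map Complex.ofRealHom)ᵀ := by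
    ext
    simp [periodMatrix]
  rw [h2, det_transpose]
  have := ((Matrix.isUnit_iff_isUnit_det _).mp h).map Complex.ofRealHom
  rwa [RingHom.map_det, RingHom.mapMatrix_apply] at this

lemma PeriodicStructure.ofReal_latticeVec (k : Fin d → ℤ) :
    (fun c => (latticeVec S.a k c : ℂ)) = S.periodMatrix *ᵥ (fun j => (k j : ℂ)) := by
  ext c
  simp [latticeVec, periodMatrix, mulVec, dotProduct, mul_comm]

lemma PeriodicStructure.eq_zero_of_mulVec_latticeVec {B : Matrix (Fin d) (Fin d) ℂ}
    (h : ∀ k, B *ᵥ (fun c => (latticeVec S.a k c : ℂ)) = 0) : B = 0 := by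
  have hA : IsUnit S.periodMatrix :=
    (Matrix.isUnit_iff_isUnit_det _).mpr S.isUnit_det_periodMatrix
  rw [← hA.mul_left_eq_zero]
  ext c j
  have h1 := congrFun (h (Pi.single j 1)) c
  simp only [latticeVec_single] at h1
  rw [Matrix.zero_apply]
  exact h1

lemma Framework.rigidSpace_le_flexSpace (C : Framework.{u} d) (𝕜 : Type) [RCLike 𝕜] :
    C.rigidSpace 𝕜 ≤ C.flexSpace 𝕜 := by
  rintro u ⟨B, hB, b, hu⟩ v w -
  have h := mulVec_dotProduct_self_of_skew hB (fun j => ((C.p v j - C.p w j : ℝ) : 𝕜))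
  rw [← h]
  refine Finset.sum_congr rfl fun j _ => ?_
  have h1 : (fun j => ((C.p v j - C.p w j : ℝ) : 𝕜)) =
      (fun j => (C.p v j : 𝕜)) - fun j => (C.p w j : 𝕜) := by
    ext; simp
  rw [h1, mulVec_sub, hu, hu, ← h1]
  simp

/-- A real framework has the same rigidity over `ℝ` and over `ℂ`: a complex flex is rigid when its
real and imaginary parts are, and a real flex is the real part of a complex one. -/
lemma Framework.firstOrderRigid_iff_complex (C : Framework.{u} d) :
    C.FirstOrderRigid ↔ C.flexSpace ℂ = C.rigidSpace ℂ := by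
  constructor
  · intro h
    refine le_antisymm (fun u hu => ?_) (C.rigidSpace_le_flexSpace ℂ)
    have hre : (fun v j => (u v j).re) ∈ C.rigidSpace ℝ := by
      rw [← h]
      intro v w hvw
      simpa using congrArg Complex.re (hu v w hvw)
    have him : (fun v j => (u v j).im) ∈ C.rigidSpace ℝ := by
      rw [← h]
      intro v w hvw
      simpa using congrArg Complex.im (hu v w hvw)
    obtain ⟨B, hB, b, h1⟩ := hre
    obtain ⟨B', hB', b', h2⟩ := him
    refine ⟨Matrix.of fun i j => ⟨B i j, B' i j⟩, ?_, fun j => ⟨b j, b' j⟩, fun v => ?_⟩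
    · ext i j
      have e1 := congrFun (congrFun hB i) j
      have e2 := congrFun (congrFun hB' i) j
      simp only [transpose_apply] at e1 e2
      apply Complex.ext <;> simp [e1, e2]
    · ext j
      have e1 := congrFun (h1 v) j
      have e2 := congrFun (h2 v) j
      simp only [mulVec, dotProduct, Pi.add_apply] at e1 e2
      apply Complex.ext
      · rw [e1]
        simp [mulVec, dotProduct]
      · rw [e2]
        simp [mulVec, dotProduct]
  · intro h
    refine le_antisymm (fun u hu => ?_) (C.rigidSpace_le_flexSpace ℝ)
    have hc : (fun v j => (u v j : ℂ)) ∈ C.rigidSpace ℂ := by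
      rw [← h]
      intro v w hvw
      have := congrArg Complex.ofReal (hu v w hvw)
      simpa using this
    obtain ⟨B, hB, b, h1⟩ := hc
    refine ⟨Matrix.of fun i j => (B i j).re, ?_, fun j => (b j).re, fun v => ?_⟩
    · ext i j
      have e1 := congrFun (congrFun hB i) j
      simp only [transpose_apply] at e1
      simp [e1]
    · ext j
      have e1 := congrArg Complex.re (congrFun (h1 v) j)
      simp only [mulVec, dotProduct, Pi.add_apply] at e1
      simpa [mulVec, dotProduct] using e1

end Rigid

namespace Motif

open Matrix

variable {d n m : ℕ} {C : Framework.{u} d} {S : PeriodicStructure C} (M : Motif S n m)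

/-! ### Labels and translations -/

lemma ext_label {β : Type*} {u w : C.V → β}
    (h : ∀ i k, u (M.label (i, k)) = w (M.label (i, k))) : u = w := by
  ext v
  rw [← M.label.apply_symm_apply v]
  exact h _ _

lemma p_label (i : Fin n) (k : Fin d → ℤ) :
    C.p (M.label (i, k)) = C.p (M.label (i, 0)) + latticeVec S.a k :=
  M.label_translate i k

lemma isTranslate_label (i : Fin n) (k l : Fin d → ℤ) :
    C.IsTranslate S.a l (M.label (i, k)) (M.label (i, k + l)) := by
  rw [Framework.IsTranslate, M.p_label i (k + l), M.p_label i k, latticeVec_add, add_assoc]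

lemma isTranslate_iff (hp : Function.Injective C.p) (i : Fin n) (k l : Fin d → ℤ) (v : C.V) :
    C.IsTranslate S.a l (M.label (i, k)) v ↔ v = M.label (i, k + l) := by
  constructor
  · intro h
    exact hp (h.trans (M.isTranslate_label i k l).symm)
  · rintro rfl
    exact M.isTranslate_label i k l

lemma isFactorPeriodic_iff (hp : Function.Injective C.p) (ω : Fin d → ℂˣ)
    (u : C.VelocityField ℂ) : S.IsFactorPeriodic ω u ↔
      ∀ i k, u (M.label (i, k)) = monom ω k • u (M.label (i, 0)) := by
  constructor
  · intro h i k
    exact h k _ _ (M.label_translate i k)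
  · intro h l v v' hv
    obtain ⟨⟨i, k⟩, rfl⟩ := M.label.surjective v
    rw [M.isTranslate_iff hp] at hv
    rw [hv, h i (k + l), h i k, monom_add, smul_smul, mul_comm]

lemma isAffinelyPeriodic_iff (hp : Function.Injective C.p) (u : C.VelocityField ℂ) :
    S.IsAffinelyPeriodic u ↔ ∃ X : Matrix (Fin d) (Fin d) ℂ,
      ∀ i k, u (M.label (i, k)) = u (M.label (i, 0)) + X *ᵥ (fun j => (k j : ℂ)) := by
  refine exists_congr fun X => ?_
  constructor
  · intro h i k
    exact h k _ _ (M.label_translate i k)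
  · intro h l v v' hv
    obtain ⟨⟨i, k⟩, rfl⟩ := M.label.surjective v
    rw [M.isTranslate_iff hp] at hv
    have hkl : (fun j => (((k + l) j : ℤ) : ℂ)) =
        (fun j => (k j : ℂ)) + fun j => (l j : ℂ) := by
      ext; simp
    rw [hv, h i (k + l), h i k, hkl, mulVec_add, add_assoc]

/-- The translation `(i, k) ↦ u(i, k + l)` of velocity fields. -/
def shift (l : Fin d → ℤ) : C.VelocityField ℂ →ₗ[ℂ] C.VelocityField ℂ where
  toFun u v := u (M.label ((M.label.symm v).1, (M.label.symm v).2 + l))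
  map_add' _ _ := rfl
  map_smul' _ _ := rfl

@[simp] lemma shift_label (l : Fin d → ℤ) (u : C.VelocityField ℂ) (i : Fin n)
    (k : Fin d → ℤ) : M.shift l u (M.label (i, k)) = u (M.label (i, k + l)) := by
  simp [shift]

lemma shift_mem_flexSpace (l : Fin d → ℤ) {u : C.VelocityField ℂ} (hu : u ∈ C.flexSpace ℂ) :
    M.shift l u ∈ C.flexSpace ℂ := by
  intro v w hvw
  obtain ⟨⟨i, k⟩, rfl⟩ := M.label.surjective v
  obtain ⟨⟨i', k'⟩, rfl⟩ := M.label.surjective w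
  have ht := M.isTranslate_label i k l
  have ht' := M.isTranslate_label i' k' l
  have h := hu _ _ (S.bar_translate l _ _ _ _ ht ht' hvw)
  rw [ht, ht'] at h
  simpa using h

lemma rigid_label {B : Matrix (Fin d) (Fin d) ℂ} {b : Fin d → ℂ} {u : C.VelocityField ℂ}
    (hu : ∀ v, u v = B *ᵥ (fun j => (C.p v j : ℂ)) + b) (i : Fin n) (k l : Fin d → ℤ) :
    u (M.label (i, k + l)) =
      u (M.label (i, k)) + B *ᵥ (fun c => (latticeVec S.a l c : ℂ)) := by
  have h : (fun j => (C.p (M.label (i, k + l)) j : ℂ)) =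
      (fun j => (C.p (M.label (i, k)) j : ℂ)) + fun c => (latticeVec S.a l c : ℂ) := by
    ext j
    rw [M.isTranslate_label i k l]
    simp
  rw [hu, hu, h, mulVec_add]
  abel

lemma shift_mem_rigidSpace (l : Fin d → ℤ) {u : C.VelocityField ℂ}
    (hu : u ∈ C.rigidSpace ℂ) : M.shift l u ∈ C.rigidSpace ℂ := by
  obtain ⟨B, hB, b, h⟩ := hu
  refine ⟨B, hB, b + B *ᵥ (fun c => (latticeVec S.a l c : ℂ)), fun v => ?_⟩
  obtain ⟨⟨i, k⟩, rfl⟩ := M.label.surjective v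
  rw [shift_label, M.rigid_label h, h]
  abel

lemma isAffinelyPeriodic_of_mem_rigidSpace (M : Motif S n m)
    (hp : Function.Injective C.p)
    {u : C.VelocityField ℂ} (hu : u ∈ C.rigidSpace ℂ) : S.IsAffinelyPeriodic u := by
  obtain ⟨B, hB, b, h⟩ := hu
  refine (M.isAffinelyPeriodic_iff hp u).mpr ⟨B * S.periodMatrix, fun i k => ?_⟩
  have := M.rigid_label h i 0 k
  rwa [zero_add, S.ofReal_latticeVec, mulVec_mulVec] at this

/-- A rigid motion flex grows at most linearly along the lattice, so it cannot have a nontrivial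
multi-factor. -/
lemma eq_zero_of_factorPeriodic_of_mem_rigidSpace {ω : Fin d → ℂˣ} (hω : ω ≠ 1)
    {u : C.VelocityField ℂ} (hu : u ∈ C.rigidSpace ℂ)
    (h : ∀ i k, u (M.label (i, k)) = monom ω k • u (M.label (i, 0))) : u = 0 := by
  obtain ⟨j, hj⟩ := Function.ne_iff.mp hω
  obtain ⟨B, -, b, hB⟩ := hu
  have h0 : ∀ i, u (M.label (i, 0)) = 0 := by
    intro i
    have e1 := M.rigid_label hB i 0 (Pi.single j 1)
    have e2 := M.rigid_label hB i (Pi.single j 1) (Pi.single j 1)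
    have e3 := h i (Pi.single j 1)
    have e4 := h i (Pi.single j 1 + Pi.single j 1)
    rw [zero_add] at e1
    rw [monom_add] at e4
    rw [monom_single] at e3 e4
    have hne : ((ω j : ℂ) - 1) ^ 2 ≠ 0 := by
      apply pow_ne_zero
      rw [sub_ne_zero]
      intro hh
      exact hj (Units.ext hh)
    ext c
    have f1 := congrFun e1 c
    have f2 := congrFun e2 c
    have f3 := congrFun e3 c
    have f4 := congrFun e4 c
    simp only [Pi.add_apply, Pi.smul_apply, smul_eq_mul] at f1 f2 f3 f4
    refine (mul_eq_zero.mp ?_).resolve_left hne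
    linear_combination f2 - f1 + 2 * f3 - f4
  refine M.ext_label fun i k => ?_
  rw [h, h0, smul_zero]
  rfl

/-- If the first differences of a flex along the lattice are rigid motion flexes, then they are
constant, by commutation of the differences and skew-symmetry; so the flex is affinely periodic. -/
lemma isAffinelyPeriodic_of_shift_sub_mem_rigidSpace (hp : Function.Injective C.p)
    {u : C.VelocityField ℂ}
    (h : ∀ j, M.shift (Pi.single j 1) u - u ∈ C.rigidSpace ℂ) : S.IsAffinelyPeriodic u := by
  rcases isEmpty_or_nonempty C.V with hV | ⟨⟨v₀⟩⟩
  · exact ⟨0, fun k v => (hV.false v).elim⟩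
  choose B hB b hu using h
  obtain ⟨⟨i₀, k₀⟩, -⟩ := M.label.surjective v₀
  have hcol : ∀ j, S.periodMatrix.col j =
      fun c => (latticeVec S.a (Pi.single j 1) c : ℂ) := by
    intro j
    ext c
    simp [PeriodicStructure.periodMatrix]
  have hcomm : ∀ i j, B i *ᵥ S.periodMatrix.col j = B j *ᵥ S.periodMatrix.col i := by
    intro i j
    have e1 := M.rigid_label (hu i) i₀ 0 (Pi.single j 1)
    have e2 := M.rigid_label (hu j) i₀ 0 (Pi.single i 1)
    rw [← hcol] at e1 e2
    simp only [Pi.sub_apply, shift_label, zero_add] at e1 e2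
    rw [add_comm (Pi.single j 1)] at e1
    rw [← sub_eq_iff_eq_add'] at e1 e2
    rw [← e1, ← e2]
    abel
  have hB0 := eq_zero_of_skew_of_mulVec_comm S.isUnit_det_periodMatrix hB hcomm
  refine (M.isAffinelyPeriodic_iff hp u).mpr ⟨Matrix.of fun c j => b j c, fun i k => ?_⟩
  have hg := eq_apply_zero_of_add_single (fun k : Fin d → ℤ => u (M.label (i, k)) -
    (Matrix.of fun c j => b j c) *ᵥ (fun j => (k j : ℂ))) (fun k j => ?_) k
  · have hz : (fun j => (((0 : Fin d → ℤ) j : ℤ) : ℂ)) = 0 := by ext; simp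
    simp only [hz, mulVec_zero, sub_zero] at hg
    exact sub_eq_iff_eq_add.mp hg
  · have hkl : (fun l => (((k + Pi.single j 1 : Fin d → ℤ) l : ℤ) : ℂ)) =
        (fun l => (k l : ℂ)) + Pi.single j 1 := by
      ext l
      by_cases hl : l = j
      · subst hl; simp
      · simp [hl]
    have e := hu j (M.label (i, k))
    rw [hB0 j, zero_mulVec, zero_add, Pi.sub_apply, shift_label, sub_eq_iff_eq_add] at e
    rw [hkl, mulVec_add, e, mulVec_single_one]
    have : (Matrix.of fun c j => b j c).col j = b j := rfl
    rw [this]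
    abel

/-! ### The pairing with Laurent polynomials -/

/-- The pairing identifies the velocity fields with the full algebraic dual of
`ℂ(z) ⊗ ℂ^{dn}`. -/
def toDual : C.VelocityField ℂ ≃ₗ[ℂ] Module.Dual ℂ (Fin n × Fin d → Laurent d) where
  toFun u :=
    { toFun := fun q => M.pairing q u
      map_add' := by
        intro q r
        simp only [pairing, Pi.add_apply, AddMonoidAlgebra.coeff_add]
        rw [← Finset.sum_add_distrib]
        refine Finset.sum_congr rfl fun x _ => ?_
        exact Finsupp.sum_add_index' (by simp) (by intros; ring)
      map_smul' := by
        intro c q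
        simp only [pairing, Pi.smul_apply, AddMonoidAlgebra.coeff_smul, RingHom.id_apply,
          smul_eq_mul, Finset.mul_sum]
        refine Finset.sum_congr rfl fun x _ => ?_
        rw [Finsupp.sum_smul_index (by simp), Finsupp.mul_sum]
        simp only [mul_assoc] }
  map_add' := by
    intro u w
    refine LinearMap.ext fun q => ?_
    change M.pairing q (u + w) = M.pairing q u + M.pairing q w
    simp only [pairing, Pi.add_apply, mul_add, Finsupp.sum_add, Finset.sum_add_distrib]
  map_smul' := by
    intro c u
    refine LinearMap.ext fun q => ?_
    change M.pairing q (c • u) = c * M.pairing q u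
    simp only [pairing, Pi.smul_apply, smul_eq_mul, Finset.mul_sum, Finsupp.mul_sum,
      mul_left_comm]
  invFun φ v j := φ (Pi.single ((M.label.symm v).1, j)
    (AddMonoidAlgebra.single (-(M.label.symm v).2) 1))
  left_inv u := by
    refine M.ext_label fun i k => ?_
    ext j
    simp only [LinearMap.coe_mk, AddHom.coe_mk, Equiv.symm_apply_apply]
    rw [pairing, Finset.sum_eq_single (i, j)]
    · simp
    · intro x _ hx
      simp [Pi.single_eq_of_ne hx]
    · simp
  right_inv φ := by
    refine LinearMap.pi_ext' fun x => ?_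
    refine AddMonoidAlgebra.lhom_ext' fun k => ?_
    ext
    simp only [LinearMap.comp_apply, LinearMap.coe_mk, AddHom.coe_mk, LinearMap.single_apply]
    rw [pairing, Finset.sum_eq_single x]
    · simp
    · intro y _ hy
      simp [Pi.single_eq_of_ne hy]
    · simp

@[simp] lemma toDual_apply (u : C.VelocityField ℂ) (q : Fin n × Fin d → Laurent d) :
    M.toDual u q = M.pairing q u := rfl

lemma pairing_single (x : Fin n × Fin d) (k : Fin d → ℤ) (c : ℂ) (u : C.VelocityField ℂ) :
    M.pairing (Pi.single x (AddMonoidAlgebra.single k c)) u =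
      c * u (M.label (x.1, -k)) x.2 := by
  rw [pairing, Finset.sum_eq_single x]
  · simp
  · intro y _ hy
    simp [Pi.single_eq_of_ne hy]
  · simp

/-- Multiplication by a monomial is dual to a translation. -/
lemma pairing_single_smul (l : Fin d → ℤ) (c : ℂ) (q : Fin n × Fin d → Laurent d)
    (u : C.VelocityField ℂ) :
    M.pairing (AddMonoidAlgebra.single l c • q) u = c * M.pairing q (M.shift (-l) u) := by
  let f : (Fin n × Fin d → Laurent d) →ₗ[ℂ] (Fin n × Fin d → Laurent d) :=
    (LinearMap.lsmul (Laurent d) (Fin n × Fin d → Laurent d)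
      (AddMonoidAlgebra.single l c)).restrictScalars ℂ
  have h : M.toDual u ∘ₗ f = c • M.toDual (M.shift (-l) u) := by
    refine LinearMap.pi_ext' fun x => ?_
    refine AddMonoidAlgebra.lhom_ext' fun k => ?_
    ext
    have hf : f (Pi.single x (AddMonoidAlgebra.single k 1)) =
        Pi.single x (AddMonoidAlgebra.single (l + k) c) := by
      change AddMonoidAlgebra.single l c • Pi.single x (AddMonoidAlgebra.single k 1) = _
      rw [← Pi.single_smul, smul_eq_mul, AddMonoidAlgebra.single_mul_single, mul_one]
    change M.pairing (f (Pi.single x (AddMonoidAlgebra.single k 1))) u =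
      c * M.pairing (Pi.single x (AddMonoidAlgebra.single k 1)) (M.shift (-l) u)
    rw [hf, pairing_single, pairing_single, shift_label, one_mul, neg_add_rev]
  exact LinearMap.congr_fun h q

/-- The pairing of a translated row of the transfer function with `u` is the flex equation of the
corresponding bar. -/
lemma pairing_transfer (e : Fin m) (u : C.VelocityField ℂ) :
    M.pairing (M.transfer e) u =
      ∑ j, (u (M.label (M.tail e)) j - u (M.label (M.head e)) j) * (M.barVec e j : ℂ) := by
  have h : M.transfer e = ∑ j, (Pi.single ((M.tail e).1, j)
      (AddMonoidAlgebra.single (-(M.tail e).2) (M.barVec e j : ℂ)) -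
      Pi.single ((M.head e).1, j)
      (AddMonoidAlgebra.single (-(M.head e).2) (M.barVec e j : ℂ))) := by
    have h0 : ∀ (i : Fin n) (f : Fin d → Laurent d) (x : Fin n × Fin d),
        (∑ j, (Pi.single (i, j) (f j) : Fin n × Fin d → Laurent d)) x =
          if x.1 = i then f x.2 else 0 := by
      rintro i f ⟨i', j'⟩
      rw [Finset.sum_apply, Finset.sum_eq_single j']
      · by_cases h : i' = i
        · subst h; simp
        · simp [h]
      · intro j _ hj
        simp [hj.symm]
      · simp
    ext1 x
    rw [Finset.sum_sub_distrib, Pi.sub_apply, h0 _ (fun j => _), h0 _ (fun j => _)]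
    rfl
  rw [← toDual_apply, h, map_sum]
  refine Finset.sum_congr rfl fun j _ => ?_
  rw [map_sub, toDual_apply, toDual_apply, pairing_single, pairing_single]
  simp only [neg_neg]
  ring

/-- A field is a flex as soon as all its translates satisfy the equations of the motif bars. -/
lemma mem_flexSpace_iff_transfer (u : C.VelocityField ℂ) :
    u ∈ C.flexSpace ℂ ↔ ∀ e l, M.pairing (M.transfer e) (M.shift l u) = 0 := by
  constructor
  · intro hu e l
    rw [pairing_transfer]
    exact M.shift_mem_flexSpace l hu _ _ (M.adj e)
  · intro h
    have key : ∀ e l, ∑ j, (u (M.label ((M.tail e).1, (M.tail e).2 + l)) j -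
        u (M.label ((M.head e).1, (M.head e).2 + l)) j) *
        ((C.p (M.label ((M.tail e).1, (M.tail e).2 + l)) j -
          C.p (M.label ((M.head e).1, (M.head e).2 + l)) j : ℝ) : ℂ) = 0 := by
      intro e l
      rw [← h e l, pairing_transfer]
      refine Finset.sum_congr rfl fun j _ => ?_
      have ht := M.isTranslate_label (M.tail e).1 (M.tail e).2 l
      have hh := M.isTranslate_label (M.head e).1 (M.head e).2 l
      rw [ht, hh, M.shift_label, M.shift_label, barVec]
      simp
    intro v w hvw
    obtain ⟨⟨e, l⟩, hel, -⟩ := M.existsUnique_bar v w hvw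
    dsimp only at hel
    rcases Sym2.eq_iff.mp hel with ⟨h1, h2⟩ | ⟨h1, h2⟩
    · rw [← h1, ← h2]
      exact key e l
    · rw [← h1, ← h2, ← key e l]
      have hsymm : ∀ (a b : ℂ) (x y : ℝ),
          (a - b) * ((x - y : ℝ) : ℂ) = (b - a) * ((y - x : ℝ) : ℂ) := by
        intros
        push_cast
        ring
      exact Finset.sum_congr rfl fun j _ => hsymm _ _ _ _

/-- The flexes are the annihilator of the module of the framework. -/
lemma mem_flexSpace_iff (u : C.VelocityField ℂ) :
    u ∈ C.flexSpace ℂ ↔ ∀ q ∈ M.module, M.pairing q u = 0 := by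
  rw [M.mem_flexSpace_iff_transfer]
  constructor
  · intro h q hq
    rw [← toDual_apply]
    refine Submodule.span_induction (p := fun q _ => ∀ r : Laurent d, M.toDual u (r • q) = 0)
      ?_ ?_ ?_ ?_ hq 1 |> fun h => by simpa using h
    · rintro _ ⟨e, rfl⟩ r
      induction r using AddMonoidAlgebra.induction_linear with
      | zero => rw [zero_smul, map_zero]
      | add q r hq hr => rw [add_smul, map_add, hq, hr, add_zero]
      | single k c => rw [toDual_apply, pairing_single_smul, h, mul_zero]
    · intro r
      rw [smul_zero, map_zero]
    · intro x y _ _ hx hy r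
      rw [smul_add, map_add, hx, hy, add_zero]
    · intro a x _ hx r
      rw [smul_smul]
      exact hx _
  · intro h e l
    have := h _ (M.module.smul_mem (AddMonoidAlgebra.single (-l) 1)
      (Submodule.subset_span ⟨e, rfl⟩))
    rwa [pairing_single_smul, one_mul, neg_neg] at this

/-- Linear functionals separate points from submodules, and every one is a velocity field. -/
lemma exists_velocityField_of_notMem (W : Submodule ℂ (Fin n × Fin d → Laurent d))
    {q : Fin n × Fin d → Laurent d} (hq : q ∉ W) :
    ∃ u : C.VelocityField ℂ, (∀ r ∈ W, M.pairing r u = 0) ∧ M.pairing q u ≠ 0 := by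
  obtain ⟨φ, hφq, hφW⟩ := Submodule.exists_le_ker_of_notMem hq
  refine ⟨M.toDual.symm φ, fun r hr => ?_, ?_⟩
  · rw [← toDual_apply, LinearEquiv.apply_symm_apply]
    exact hφW hr
  · rwa [← toDual_apply, LinearEquiv.apply_symm_apply]

end Motif

/-! ### Localization at the characters of the lattice -/

instance : IsNoetherianRing (Laurent d) :=
  Algebra.FiniteType.isNoetherianRing ℂ _

/-- By the Nullstellensatz, every maximal ideal of the Laurent polynomial ring is the kernel of a
character. -/
lemma Laurent.exists_ker_eq {d : ℕ} (I : Ideal (Laurent d)) [I.IsMaximal] :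
    ∃ χ : Laurent d →ₐ[ℂ] ℂ, RingHom.ker χ = I := by
  let _ : Field (Laurent d ⧸ I) := Ideal.Quotient.field I
  have : Module.Finite ℂ (Laurent d ⧸ I) := finite_of_finite_type_of_isJacobsonRing ℂ _
  have hb : Function.Bijective (algebraMap ℂ (Laurent d ⧸ I)) :=
    IsAlgClosed.algebraMap_bijective_of_isIntegral
  let e : ℂ ≃ₐ[ℂ] (Laurent d ⧸ I) := AlgEquiv.ofBijective (Algebra.ofId ℂ _) hb
  refine ⟨(e.symm : (Laurent d ⧸ I) →ₐ[ℂ] ℂ).comp (Ideal.Quotient.mkₐ ℂ I), ?_⟩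
  ext r
  simp [RingHom.mem_ker, Ideal.Quotient.eq_zero_iff_mem]

/-- A nonzero element of a finitely generated module over a Noetherian ring stays nonzero modulo
some power of some maximal ideal: take a maximal ideal that contains the annihilator of the
element, and apply the Krull intersection theorem. -/
lemma exists_isMaximal_notMem_pow_smul {R N : Type*} [CommRing R] [IsNoetherianRing R]
    [AddCommGroup N] [Module R N] [Module.Finite R N] {x : N} (hx : x ≠ 0) :
    ∃ I : Ideal R, I.IsMaximal ∧ ∃ t : ℕ, x ∉ I ^ t • (⊤ : Submodule R N) := by
  have hne : Ideal.torsionOf R N x ≠ ⊤ := by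
    rwa [Ne, Ideal.torsionOf_eq_top_iff]
  obtain ⟨I, hI, hle⟩ := Ideal.exists_le_maximal _ hne
  refine ⟨I, hI, ?_⟩
  by_contra! h
  obtain ⟨r, hr⟩ := (I.mem_iInf_smul_pow_eq_bot_iff x).mp (by simpa using h)
  have h1 : (1 - r : R) ∈ I := hle (by
    rw [Ideal.mem_torsionOf_iff, sub_smul, one_smul, hr, sub_self])
  refine hI.ne_top ((Ideal.eq_top_iff_one I).mpr ?_)
  simpa using I.add_mem h1 r.2

namespace Motif

open Matrix

variable {d n m : ℕ} {C : Framework.{u} d} {S : PeriodicStructure C} (M : Motif S n m)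

/-- A flex that is annihilated by a power of the ideal of a character `χ` is a rigid motion flex.
The multi-factor `ω` of `χ` records the values at `z_j⁻¹`, in accordance with the pairing. -/
lemma mem_rigidSpace_of_pairing_pow_ker (hp : Function.Injective C.p)
    (hfac : S.NoFactorPeriodicFlex) (hflex : S.FlexibleLatticeRigid)
    (χ : Laurent d →ₐ[ℂ] ℂ) (t : ℕ) {u : C.VelocityField ℂ} (hu : u ∈ C.flexSpace ℂ)
    (hann : ∀ r ∈ RingHom.ker χ ^ t, ∀ q, M.pairing (r • q) u = 0) : u ∈ C.rigidSpace ℂ := by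
  have hmul : ∀ k l : Fin d → ℤ, χ (AddMonoidAlgebra.single (k + l) 1) =
      χ (AddMonoidAlgebra.single k 1) * χ (AddMonoidAlgebra.single l 1) := by
    intro k l
    rw [← map_mul, AddMonoidAlgebra.single_mul_single, mul_one]
  have hone : χ (AddMonoidAlgebra.single 0 1) = 1 := map_one χ
  let ω : Fin d → ℂˣ := fun j =>
    { val := χ (AddMonoidAlgebra.single (-Pi.single j 1) 1)
      inv := χ (AddMonoidAlgebra.single (Pi.single j 1) 1)
      val_inv := by rw [← hmul, neg_add_cancel, hone]
      inv_val := by rw [← hmul, add_neg_cancel, hone] }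
  -- the differences twisted by `ω` lower the exponent of the annihilating power
  have hstep : ∀ (t : ℕ) (u : C.VelocityField ℂ),
      (∀ r ∈ RingHom.ker χ ^ (t + 1), ∀ q, M.pairing (r • q) u = 0) → ∀ j,
      ∀ r ∈ RingHom.ker χ ^ t, ∀ q,
        M.pairing (r • q) (M.shift (Pi.single j 1) u - (ω j : ℂ) • u) = 0 := by
    intro t u h j r hr q
    have hz : AddMonoidAlgebra.single (-Pi.single j 1) 1 - algebraMap ℂ (Laurent d) (ω j) ∈
        RingHom.ker χ := by
      rw [RingHom.mem_ker, map_sub, AlgHom.commutes]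
      exact sub_self _
    have h1 := h _ (by rw [pow_succ]; exact Ideal.mul_mem_mul hr hz) q
    rw [mul_comm, sub_mul, sub_smul, mul_smul, mul_smul, algebraMap_smul, ← toDual_apply,
      map_sub, (M.toDual u).map_smul, toDual_apply, toDual_apply, pairing_single_smul, neg_neg,
      one_mul] at h1
    change M.toDual (_ - _) (r • q) = 0
    rw [map_sub M.toDual, map_smul M.toDual, LinearMap.sub_apply, LinearMap.smul_apply]
    exact h1
  have hmem : ∀ {u : C.VelocityField ℂ} (j) (c : ℂ), u ∈ C.flexSpace ℂ →
      M.shift (Pi.single j 1) u - c • u ∈ C.flexSpace ℂ := fun j c hu =>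
    Submodule.sub_mem _ (M.shift_mem_flexSpace _ hu) (Submodule.smul_mem _ _ hu)
  have hbase : ∀ u : C.VelocityField ℂ,
      (∀ r ∈ RingHom.ker χ ^ 0, ∀ q, M.pairing (r • q) u = 0) → u = 0 := by
    intro u h
    rw [← M.toDual.map_eq_zero_iff]
    refine LinearMap.ext fun q => ?_
    simpa using h 1 (by simp) q
  by_cases hω : ω = 1
  · induction t generalizing u with
    | zero => rw [hbase u hann]; exact Submodule.zero_mem _
    | succ t ih =>
      have h1 : ∀ j, M.shift (Pi.single j 1) u - u ∈ C.rigidSpace ℂ := by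
        intro j
        have h2 := ih (hmem j (ω j) hu) (hstep t u hann j)
        simpa [hω] using h2
      have h3 : u ∈ {u | u ∈ C.flexSpace ℂ ∧ S.IsAffinelyPeriodic u} :=
        ⟨hu, M.isAffinelyPeriodic_of_shift_sub_mem_rigidSpace hp h1⟩
      rw [hflex] at h3
      exact h3
  · suffices u = 0 by rw [this]; exact Submodule.zero_mem _
    induction t generalizing u with
    | zero => exact hbase u hann
    | succ t ih =>
      have h1 : ∀ j k i, u (M.label (i, k + Pi.single j 1)) =
          (ω j : ℂ) • u (M.label (i, k)) := by
        intro j k i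
        have h2 := congrFun (ih (hmem j (ω j) hu) (hstep t u hann j)) (M.label (i, k))
        rw [Pi.sub_apply, shift_label, Pi.zero_apply, sub_eq_zero] at h2
        exact h2
      have h3 : ∀ i k, u (M.label (i, k)) = monom ω k • u (M.label (i, 0)) := by
        intro i k
        have hg := eq_apply_zero_of_add_single
          (fun k : Fin d → ℤ => (monom ω k)⁻¹ • u (M.label (i, k))) (fun k j => ?_) k
        · simp only [monom_zero, inv_one, one_smul] at hg
          rw [← hg, smul_inv_smul₀ (monom_ne_zero ω k)]
        · simp only [h1, monom_add, monom_single, smul_smul]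
          congr 1
          have := monom_ne_zero ω k
          have := (ω j).ne_zero
          field_simp
      exact M.eq_zero_of_factorPeriodic_of_mem_rigidSpace hω
        (hfac ω u hu ((M.isFactorPeriodic_iff hp ω u).mpr h3)) h3

lemma module_subset_rigidityModule :
    (M.module : Set (Fin n × Fin d → Laurent d)) ⊆ M.rigidityModule := fun q hq _ hu =>
  (M.mem_flexSpace_iff _).mp (C.rigidSpace_le_flexSpace ℂ hu) q hq

/-- Spectral synthesis: an element outside the module of the framework is detected by a flex that
is annihilated by a power of a maximal ideal, and such flexes are rigid motion flexes. -/
lemma module_eq_rigidityModule (hp : Function.Injective C.p)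
    (hfac : S.NoFactorPeriodicFlex) (hflex : S.FlexibleLatticeRigid) :
    (M.module : Set (Fin n × Fin d → Laurent d)) = M.rigidityModule := by
  refine M.module_subset_rigidityModule.antisymm fun q hq => ?_
  by_contra hqM
  have hne : M.module.mkQ q ≠ 0 := by
    rwa [Ne, Submodule.mkQ_apply, Submodule.Quotient.mk_eq_zero]
  obtain ⟨I, hI, t, ht⟩ := exists_isMaximal_notMem_pow_smul (R := Laurent d) hne
  obtain ⟨χ, rfl⟩ := Laurent.exists_ker_eq I
  have hW : q ∉ (((RingHom.ker χ ^ t • ⊤ : Submodule (Laurent d) _).comap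
      M.module.mkQ).restrictScalars ℂ) := ht
  obtain ⟨u, hu, hqu⟩ := M.exists_velocityField_of_notMem _ hW
  refine hqu (hq u (M.mem_rigidSpace_of_pairing_pow_ker hp hfac hflex χ t ?_ ?_))
  · refine (M.mem_flexSpace_iff u).mpr fun r hr => hu r ?_
    rw [Submodule.restrictScalars_mem, Submodule.mem_comap, Submodule.mkQ_apply,
      (Submodule.Quotient.mk_eq_zero _).mpr hr]
    exact Submodule.zero_mem _
  · intro r hr q
    refine hu _ ?_
    rw [Submodule.restrictScalars_mem, Submodule.mem_comap, map_smul]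
    exact Submodule.smul_mem_smul hr trivial

end Motif

/-! ### The dimension of the space of rigid motion flexes -/

section RigidMap

open Matrix

variable {d : ℕ}

/-- The parametrization `(B, b) ↦ (v ↦ B p(v) + b)` of the rigid motion flexes. -/
def Framework.rigidMap (C : Framework.{u} d) :
    (skewMatrices d × (Fin d → ℂ)) →ₗ[ℂ] C.VelocityField ℂ where
  toFun B v := B.1.1 *ᵥ (fun j => (C.p v j : ℂ)) + B.2
  map_add' B B' := by
    ext1 v
    simp only [Prod.fst_add, Prod.snd_add, Submodule.coe_add, Pi.add_apply, add_mulVec]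
    abel
  map_smul' c B := by
    ext1 v
    simp only [Prod.smul_fst, Prod.smul_snd, Submodule.coe_smul, Pi.smul_apply, smul_mulVec,
      smul_add, RingHom.id_apply]

lemma Framework.range_rigidMap (C : Framework.{u} d) :
    LinearMap.range C.rigidMap = C.rigidSpace ℂ := by
  ext u
  constructor
  · rintro ⟨⟨⟨B, hB⟩, b⟩, rfl⟩
    exact ⟨B, hB, b, fun _ => rfl⟩
  · rintro ⟨B, hB, b, h⟩
    exact ⟨⟨⟨B, hB⟩, b⟩, (funext h).symm⟩

instance (C : Framework.{u} d) : FiniteDimensional ℂ (C.rigidSpace ℂ) := by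
  rw [← C.range_rigidMap]
  infer_instance

end RigidMap

namespace Motif

open Matrix

variable {d n m : ℕ} {C : Framework.{u} d} {S : PeriodicStructure C} (M : Motif S n m)

lemma rigidMap_injective [Nonempty C.V] (M : Motif S n m) :
    Function.Injective C.rigidMap := by
  rw [← LinearMap.ker_eq_bot, LinearMap.ker_eq_bot']
  rintro ⟨⟨B, hB⟩, b⟩ h
  obtain ⟨⟨i, k⟩, -⟩ := M.label.surjective (Classical.arbitrary C.V)
  have h' : ∀ v, (0 : C.VelocityField ℂ) v = B *ᵥ (fun j => (C.p v j : ℂ)) + b :=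
    fun v => (congrFun h v).symm
  have hB0 : B = 0 := by
    refine S.eq_zero_of_mulVec_latticeVec fun l => ?_
    simpa using (M.rigid_label h' i k l).symm
  subst hB0
  have hb : b = 0 := by
    simpa using (h' (M.label (i, k))).symm
  subst hb
  rfl

lemma finrank_rigidSpace [Nonempty C.V] (M : Motif S n m) :
    Module.finrank ℂ (C.rigidSpace ℂ) = d * (d - 1) / 2 + d := by
  rw [← C.range_rigidMap, LinearMap.finrank_range_of_inj M.rigidMap_injective,
    Module.finrank_prod, finrank_skewMatrices, Module.finrank_fin_fun]

/-! ### Exponential velocity fields -/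

lemma mem_expSpace_of_factorPeriodic {ω : Fin d → ℂˣ} {u : C.VelocityField ℂ}
    (h : ∀ i k, u (M.label (i, k)) = monom ω k • u (M.label (i, 0))) : u ∈ M.expSpace := by
  refine Submodule.subset_span ⟨ω, 1, fun i => u (M.label (i, 0)), fun i k => ?_⟩
  rw [map_one, one_mul, h]

lemma mem_expSpace_of_affine {X : Matrix (Fin d) (Fin d) ℂ} {u : C.VelocityField ℂ}
    (h : ∀ i k, u (M.label (i, k)) = u (M.label (i, 0)) + X *ᵥ (fun j => (k j : ℂ))) :
    u ∈ M.expSpace := by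
  let w : C.VelocityField ℂ := fun v => u (M.label ((M.label.symm v).1, 0))
  let f : Fin d → C.VelocityField ℂ := fun j v => ((M.label.symm v).2 j : ℂ) • X.col j
  have hu : u = w + ∑ j, f j := by
    refine M.ext_label fun i k => ?_
    rw [h]
    ext c
    simp [w, f, mulVec, dotProduct, mul_comm]
  rw [hu]
  refine Submodule.add_mem _ ?_ (Submodule.sum_mem _ fun j _ => ?_)
  · refine Submodule.subset_span ⟨1, 1, fun i => u (M.label (i, 0)), fun i k => ?_⟩
    simp [w]
  · refine Submodule.subset_span ⟨1, MvPolynomial.X j, fun _ => X.col j, fun i k => ?_⟩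
    simp [f]

lemma rigidSpace_le_expSpace (hp : Function.Injective C.p) : C.rigidSpace ℂ ≤ M.expSpace := by
  intro u hu
  obtain ⟨X, hX⟩ := (M.isAffinelyPeriodic_iff hp u).mp
    (M.isAffinelyPeriodic_of_mem_rigidSpace hp hu)
  exact M.mem_expSpace_of_affine hX

/-! ### The rigidity module -/

/-- The rigidity module determines the rigid motion flexes, since these form a finite-dimensional
space. -/
lemma mem_rigidSpace_of_pairing_rigidityModule {u : C.VelocityField ℂ}
    (hu : ∀ q ∈ M.rigidityModule, M.pairing q u = 0) : u ∈ C.rigidSpace ℂ := by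
  have h : M.toDual u ∈ (C.rigidSpace ℂ).map (M.toDual : C.VelocityField ℂ →ₗ[ℂ]
      Module.Dual ℂ (Fin n × Fin d → Laurent d)) := by
    rw [← Subspace.dualCoannihilator_dualAnnihilator_eq
      (W := (C.rigidSpace ℂ).map (M.toDual : C.VelocityField ℂ →ₗ[ℂ]
      Module.Dual ℂ (Fin n × Fin d → Laurent d))),
      Submodule.mem_dualAnnihilator]
    intro q hq
    refine hu q fun w hw => ?_
    rw [Submodule.mem_dualCoannihilator] at hq
    exact hq _ ⟨w, hw, rfl⟩
  obtain ⟨w, hw, hwu⟩ := h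
  rwa [← M.toDual.injective hwu]

lemma single_smul_mem_rigidityModule (l : Fin d → ℤ) {q : Fin n × Fin d → Laurent d}
    (hq : q ∈ M.rigidityModule) :
    (AddMonoidAlgebra.single l (1 : ℂ) : Laurent d) • q ∈ M.rigidityModule := by
  intro u hu
  rw [pairing_single_smul, hq _ (M.shift_mem_rigidSpace _ hu), mul_zero]

lemma exists_single_smul_mem_polynomialVectors (q : Fin n × Fin d → Laurent d) :
    ∃ l : Fin d → ℤ,
      (AddMonoidAlgebra.single l (1 : ℂ) : Laurent d) • q ∈ polynomialVectors d n := by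
  let T : Finset (Fin d → ℤ) := Finset.univ.biUnion fun x => (q x).coeff.support
  obtain ⟨l, hl⟩ := (T.image fun k => -k).exists_le
  refine ⟨l, fun x k hk => ?_⟩
  have hk' : (q x).coeff (-l + k) ≠ 0 := by
    rw [Finsupp.mem_support_iff] at hk
    intro h0
    apply hk
    have e := AddMonoidAlgebra.coeff_single_mul_apply (q x) (1 : ℂ) l k
    rw [h0] at e
    simpa using e
  have h1 : -l + k ∈ T :=
    Finset.mem_biUnion.mpr ⟨x, Finset.mem_univ _, Finsupp.mem_support_iff.mpr hk'⟩
  have h2 := hl _ (Finset.mem_image_of_mem _ h1)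
  rw [neg_add_rev, neg_neg] at h2
  simpa using h2

/-- Both modules are stable under all monomials, so their polynomial parts determine them. -/
lemma module_eq_rigidityModule_iff_polynomialVectors :
    (M.module : Set (Fin n × Fin d → Laurent d)) = M.rigidityModule ↔
      (M.module : Set (Fin n × Fin d → Laurent d)) ∩ polynomialVectors d n =
        M.rigidityModule ∩ polynomialVectors d n := by
  refine ⟨fun h => by rw [h], fun h => M.module_subset_rigidityModule.antisymm fun q hq => ?_⟩
  obtain ⟨l, hl⟩ := exists_single_smul_mem_polynomialVectors q
  have h1 : (AddMonoidAlgebra.single l (1 : ℂ) : Laurent d) • q ∈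
      (M.module : Set (Fin n × Fin d → Laurent d)) ∩ polynomialVectors d n := by
    rw [h]
    exact ⟨M.single_smul_mem_rigidityModule l hq, hl⟩
  have h2 := M.module.smul_mem (AddMonoidAlgebra.single (-l) 1) h1.1
  rwa [smul_smul, AddMonoidAlgebra.single_mul_single, neg_add_cancel, mul_one,
    ← AddMonoidAlgebra.one_def, one_smul] at h2

/-! ### Ranks -/

lemma _root_.Matrix.rank_add_finrank_ker_mulVecLin {ι κ : Type*} [Fintype ι] [Fintype κ]
    [DecidableEq κ] (A : Matrix ι κ ℂ) :
    A.rank + Module.finrank ℂ (LinearMap.ker A.mulVecLin) = Fintype.card κ := by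
  rw [Matrix.rank, LinearMap.finrank_range_add_finrank_ker, Module.finrank_fintype_fun_eq_card]

/-- The factor-periodic velocity field with multi-factor `ω` and values `w` on the motif. -/
def factorField (ω : Fin d → ℂˣ) (w : Fin n × Fin d → ℂ) : C.VelocityField ℂ :=
  fun v j => monom ω (M.label.symm v).2 * w ((M.label.symm v).1, j)

lemma factorField_label (ω : Fin d → ℂˣ) (w : Fin n × Fin d → ℂ) (i : Fin n)
    (k : Fin d → ℤ) (j : Fin d) :
    M.factorField ω w (M.label (i, k)) j = monom ω k * w (i, j) := by
  simp [factorField]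

lemma factorField_periodic (ω : Fin d → ℂˣ) (w : Fin n × Fin d → ℂ) (i : Fin n)
    (k : Fin d → ℤ) :
    M.factorField ω w (M.label (i, k)) = monom ω k • M.factorField ω w (M.label (i, 0)) := by
  ext j
  simp [factorField_label]

lemma shift_factorField (ω : Fin d → ℂˣ) (w : Fin n × Fin d → ℂ) (l : Fin d → ℤ) :
    M.shift l (M.factorField ω w) = monom ω l • M.factorField ω w := by
  refine M.ext_label fun i k => ?_
  ext j
  rw [shift_label, factorField_label, monom_add, Pi.smul_apply, Pi.smul_apply,
    factorField_label, smul_eq_mul]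
  ring

/-- The pairing with the factor-periodic field of multi-factor `ω` evaluates at `ω⁻¹`. -/
lemma pairing_transfer_factorField (ω : Fin d → ℂˣ) (w : Fin n × Fin d → ℂ) (e : Fin m) :
    M.pairing (M.transfer e) (M.factorField ω w) = (M.transferAt ω⁻¹ *ᵥ w) e := by
  rw [pairing, mulVec, dotProduct]
  refine Finset.sum_congr rfl fun x _ => ?_
  rw [transferAt, Matrix.map_apply, Laurent.eval, Finsupp.sum_mul]
  refine Finsupp.sum_congr fun k _ => ?_
  rw [factorField_label, ← monom_inv_neg, neg_neg]
  ring

lemma factorField_mem_flexSpace_iff (ω : Fin d → ℂˣ) (w : Fin n × Fin d → ℂ) :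
    M.factorField ω w ∈ C.flexSpace ℂ ↔ M.transferAt ω⁻¹ *ᵥ w = 0 := by
  rw [M.mem_flexSpace_iff_transfer]
  constructor
  · intro h
    ext e
    rw [← pairing_transfer_factorField]
    have := h e 0
    rwa [shift_factorField, monom_zero, one_smul] at this
  · intro h e l
    rw [shift_factorField, ← toDual_apply, map_smul, LinearMap.smul_apply, toDual_apply,
      pairing_transfer_factorField, h]
    simp

/-- The velocity field with values `x` on the motif joints that changes by `-Y k` under the
translation by `a(k)`, where `Y` consists of the last `d²` coordinates of `x`. The sign is that of
the entries `(l_c - k_c) p(e)` of `R_fper(C)`, for a bar from the cell `k` to the cell `l`. -/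
def affineField : (Fin n × Fin d ⊕ Fin d × Fin d → ℂ) →ₗ[ℂ] C.VelocityField ℂ where
  toFun x v j := x (Sum.inl ((M.label.symm v).1, j)) -
    ∑ c, ((M.label.symm v).2 c : ℂ) * x (Sum.inr (c, j))
  map_add' x y := by
    ext v j
    simp only [Pi.add_apply, mul_add, Finset.sum_add_distrib]
    ring
  map_smul' c x := by
    ext v j
    simp only [Pi.smul_apply, smul_eq_mul, RingHom.id_apply, mul_sub, Finset.mul_sum,
      mul_left_comm]

lemma affineField_label (x : Fin n × Fin d ⊕ Fin d × Fin d → ℂ) (i : Fin n)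
    (k : Fin d → ℤ) (j : Fin d) : M.affineField x (M.label (i, k)) j =
      x (Sum.inl (i, j)) - ∑ c, (k c : ℂ) * x (Sum.inr (c, j)) := by
  simp [affineField]

lemma affineField_injective [Nonempty C.V] : Function.Injective M.affineField := by
  rw [← LinearMap.ker_eq_bot, LinearMap.ker_eq_bot']
  intro x h
  obtain ⟨⟨i₀, -⟩, -⟩ := M.label.surjective (Classical.arbitrary C.V)
  have h1 : ∀ (i : Fin n) (k : Fin d → ℤ) (j : Fin d), x (Sum.inl (i, j)) - 
      ∑ c, (k c : ℂ) * x (Sum.inr (c, j)) = 0 := by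
    intro i k j
    rw [← affineField_label, h]
    rfl
  have h2 : ∀ i j, x (Sum.inl (i, j)) = 0 := by
    intro i j
    simpa using h1 i 0 j
  ext (⟨i, j⟩ | ⟨c, j⟩)
  · exact h2 i j
  · have := h1 i₀ (Pi.single c 1) j
    rw [h2, Finset.sum_eq_single c] at this
    · simpa using this
    · intro b _ hb
      simp [hb]
    · simp

lemma affineField_mem_flexSpace_iff (x : Fin n × Fin d ⊕ Fin d × Fin d → ℂ) :
    M.affineField x ∈ C.flexSpace ℂ ↔ M.flexibleMatrix *ᵥ x = 0 := by
  have key : ∀ e l, M.pairing (M.transfer e) (M.shift l (M.affineField x)) =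
      (M.flexibleMatrix *ᵥ x) e := by
    intro e l
    have h1 : ∀ (i : Fin n) (j : Fin d),
        ∑ i', (if i' = i then (M.barVec e j : ℂ) else 0) * x (Sum.inl (i', j)) =
          M.barVec e j * x (Sum.inl (i, j)) := by
      intro i j
      simp
    rw [pairing_transfer, mulVec, dotProduct, Fintype.sum_sum_type, Fintype.sum_prod_type_right,
      Fintype.sum_prod_type_right, ← Finset.sum_add_distrib]
    refine Finset.sum_congr rfl fun j _ => ?_
    simp only [flexibleMatrix, sub_mul (ite _ _ _), Finset.sum_sub_distrib, h1]
    have h2 : ∀ v : Fin n × (Fin d → ℤ), M.shift l (M.affineField x) (M.label v) j =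
        x (Sum.inl (v.1, j)) - ∑ c, ((v.2 c : ℂ) + l c) * x (Sum.inr (c, j)) := by
      intro v
      rw [← Prod.mk.eta (p := v), shift_label, affineField_label]
      simp
    rw [h2, h2]
    simp only [add_mul, Finset.sum_add_distrib, Int.cast_sub, sub_mul, Finset.sum_sub_distrib]
    have h3 : ∀ f : Fin d → ℤ, ∑ c, (f c : ℂ) * (M.barVec e j : ℂ) * x (Sum.inr (c, j)) =
        M.barVec e j * ∑ c, (f c : ℂ) * x (Sum.inr (c, j)) := by
      intro f
      rw [Finset.mul_sum]
      exact Finset.sum_congr rfl fun c _ => by ring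
    rw [h3, h3]
    ring
  rw [M.mem_flexSpace_iff_transfer]
  constructor
  · intro h
    ext e
    rw [← key e 0, h]
    rfl
  · intro h e l
    rw [key, h]
    rfl

lemma map_affineField_ker (hp : Function.Injective C.p) :
    ((LinearMap.ker M.flexibleMatrix.mulVecLin).map M.affineField :
      Set (C.VelocityField ℂ)) = {u | u ∈ C.flexSpace ℂ ∧ S.IsAffinelyPeriodic u} := by
  ext u
  constructor
  · rintro ⟨x, hx, rfl⟩
    refine ⟨(M.affineField_mem_flexSpace_iff x).mpr hx, (M.isAffinelyPeriodic_iff hp _).mpr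
      ⟨Matrix.of fun j c => -x (Sum.inr (c, j)), fun i k => ?_⟩⟩
    ext j
    rw [Pi.add_apply, affineField_label, affineField_label]
    simp [mulVec, dotProduct, sub_eq_add_neg, mul_comm]
  · rintro ⟨hu, h⟩
    obtain ⟨X, hX⟩ := (M.isAffinelyPeriodic_iff hp u).mp h
    let x : Fin n × Fin d ⊕ Fin d × Fin d → ℂ :=
      Sum.elim (fun y => u (M.label (y.1, 0)) y.2) (fun y => -X y.2 y.1)
    have hx : M.affineField x = u := by
      refine M.ext_label fun i k => ?_
      ext j
      rw [affineField_label, hX]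
      simp [x, mulVec, dotProduct, mul_comm]
    refine ⟨x, ?_, hx⟩
    rw [SetLike.mem_coe, LinearMap.mem_ker, mulVecLin_apply,
      ← M.affineField_mem_flexSpace_iff, hx]
    exact hu

/-- Rank-nullity: the rank is extremal exactly when the space of flexible lattice periodic flexes has
no larger dimension than its subspace of rigid motion flexes. -/
lemma flexibleLatticeRigid_iff [Nonempty C.V] (hp : Function.Injective C.p) :
    S.FlexibleLatticeRigid ↔ M.FlexibleRankExtremal := by
  have hle : C.rigidSpace ℂ ≤
      (LinearMap.ker M.flexibleMatrix.mulVecLin).map M.affineField := by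
    rw [← SetLike.coe_subset_coe, M.map_affineField_ker hp]
    exact fun u hu =>
      ⟨C.rigidSpace_le_flexSpace ℂ hu, M.isAffinelyPeriodic_of_mem_rigidSpace hp hu⟩
  have hcard := M.flexibleMatrix.rank_add_finrank_ker_mulVecLin
  rw [(Submodule.equivMapOfInjective M.affineField M.affineField_injective _).finrank_eq,
    Fintype.card_sum, Fintype.card_prod, Fintype.card_prod, Fintype.card_fin, Fintype.card_fin,
    mul_comm n d] at hcard
  have hrig := finrank_rigidSpace M
  -- the two halves of `d²`: the skew-symmetric matrices, and their complement
  have hhalf : d * (d - 1) / 2 + (d * (d - 1) / 2 + d) = d * d := by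
    have h2 : 2 ∣ d * (d - 1) := (Nat.even_mul_pred_self d).two_dvd
    have h3 : d * (d - 1) + d = d * d := by
      cases d with
      | zero => rfl
      | succ d => rw [Nat.add_sub_cancel]; ring
    omega
  rw [PeriodicStructure.FlexibleLatticeRigid, ← M.map_affineField_ker hp, SetLike.coe_set_eq,
    FlexibleRankExtremal]
  constructor
  · intro h
    rw [h, hrig] at hcard
    omega
  · intro h
    refine (Submodule.eq_of_le_of_finrank_eq hle ?_).symm
    rw [hrig]
    omega

/-- The kernel of `Ψ(1)` consists of the periodic flexes; when these are rigid motion flexes, they are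
the translations, because a periodic field `B p + b` has `B = 0`. -/
lemma transferRankExtremal (hp : Function.Injective C.p) [Nonempty C.V]
    (hfac : S.NoFactorPeriodicFlex) : M.TransferRankExtremal := by
  have hrigid : ∀ ω w, M.transferAt ω⁻¹ *ᵥ w = 0 → M.factorField ω w ∈ C.rigidSpace ℂ :=
    fun ω w hw => hfac ω _ ((M.factorField_mem_flexSpace_iff ω w).mpr hw)
      ((M.isFactorPeriodic_iff hp ω _).mpr (M.factorField_periodic ω w))
  refine ⟨fun ω hω => ?_, ?_⟩
  · have hker : LinearMap.ker (M.transferAt ω).mulVecLin = ⊥ := by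
      rw [LinearMap.ker_eq_bot']
      intro w hw
      have h0 := M.eq_zero_of_factorPeriodic_of_mem_rigidSpace (inv_ne_one.mpr hω)
        (hrigid ω⁻¹ w (by rw [inv_inv]; exact hw)) (M.factorField_periodic ω⁻¹ w)
      ext ⟨i, j⟩
      have := M.factorField_label ω⁻¹ w i 0 j
      rw [h0] at this
      simpa using this.symm
    have := (M.transferAt ω).rank_add_finrank_ker_mulVecLin
    rw [hker, finrank_bot, Fintype.card_prod, Fintype.card_fin, Fintype.card_fin] at this
    rw [mul_comm]
    exact this
  · obtain ⟨⟨i₀, -⟩, -⟩ := M.label.surjective (Classical.arbitrary C.V)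
    let T : (Fin d → ℂ) →ₗ[ℂ] (Fin n × Fin d → ℂ) := LinearMap.funLeft ℂ ℂ Prod.snd
    have hT : Function.Injective T :=
      LinearMap.funLeft_injective_of_surjective ℂ ℂ _ fun j => ⟨(i₀, j), rfl⟩
    have hker : LinearMap.ker (M.transferAt 1).mulVecLin = LinearMap.range T := by
      ext w
      rw [LinearMap.mem_ker, mulVecLin_apply]
      constructor
      · intro hw
        obtain ⟨B, -, b, hB⟩ := hrigid 1 w (by rwa [inv_one])
        have hB0 : B = 0 := by
          refine S.eq_zero_of_mulVec_latticeVec fun l => ?_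
          have := M.rigid_label hB i₀ 0 l
          rw [zero_add, M.factorField_periodic, monom_one, one_smul] at this
          exact left_eq_add.mp this
        refine ⟨b, ?_⟩
        ext ⟨i, j⟩
        have := congrFun (hB (M.label (i, 0))) j
        rw [factorField_label, monom_one, one_mul, hB0] at this
        simpa [T, LinearMap.funLeft_apply] using this.symm
      · rintro ⟨b, rfl⟩
        have := (M.factorField_mem_flexSpace_iff 1 (T b)).mp
          (C.rigidSpace_le_flexSpace ℂ ⟨0, by simp, b, fun v => ?_⟩)
        · rwa [inv_one] at this
        · ext j
          simp [factorField, T, LinearMap.funLeft_apply]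
    have := (M.transferAt 1).rank_add_finrank_ker_mulVecLin
    rw [hker, LinearMap.finrank_range_of_inj hT, Module.finrank_fin_fun, Fintype.card_prod,
      Fintype.card_fin, Fintype.card_fin] at this
    rw [mul_comm d n]
    exact this

lemma noFactorPeriodicFlex (hp : Function.Injective C.p) (htr : M.TransferRankExtremal)
    (hflex : S.FlexibleLatticeRigid) : S.NoFactorPeriodicFlex := by
  intro ω u hu hper
  by_cases hω : ω = 1
  · have h1 : u ∈ {u | u ∈ C.flexSpace ℂ ∧ S.IsAffinelyPeriodic u} :=
      ⟨hu, 0, fun k v v' h => by rw [hper k v v' h, hω]; simp⟩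
    rw [hflex] at h1
    exact h1
  · have h := (M.isFactorPeriodic_iff hp ω u).mp hper
    let w : Fin n × Fin d → ℂ := fun x => u (M.label (x.1, 0)) x.2
    have hw : u = M.factorField ω w := by
      refine M.ext_label fun i k => ?_
      ext j
      rw [factorField_label, h]
      rfl
    have hrank := (M.transferAt ω⁻¹).rank_add_finrank_ker_mulVecLin
    rw [htr.1 _ (inv_ne_one.mpr hω), Fintype.card_prod, Fintype.card_fin, Fintype.card_fin,
      mul_comm n d, Nat.add_eq_left, Submodule.finrank_eq_zero] at hrank
    have hw0 : w = 0 := LinearMap.ker_eq_bot'.mp hrank w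
      ((M.factorField_mem_flexSpace_iff ω w).mp (hw ▸ hu))
    have hu0 : u = 0 := by
      rw [hw, hw0]
      refine M.ext_label fun i k => ?_
      ext j
      simp [factorField_label]
    rw [hu0]
    exact Submodule.zero_mem _

end Motif

end Crystal

end

theorem theorem3p2 {d n m : ℕ} (C : Crystal.CrystalFramework.{u} d)
    (S : Crystal.PeriodicStructure C.toFramework) (M : Crystal.Motif S n m) :
    List.TFAE [
      C.FirstOrderRigid,
      M.ExponentiallyRigid,
      S.NoFactorPeriodicFlex ∧ S.FlexibleLatticeRigid,
      M.TransferRankExtremal ∧ M.FlexibleRankExtremal,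
      (M.module : Set (Fin n × Fin d → Crystal.Laurent d)) = M.rigidityModule,
      (M.module : Set (Fin n × Fin d → Crystal.Laurent d)) ∩ Crystal.polynomialVectors d n =
        M.rigidityModule ∩ Crystal.polynomialVectors d n] := by
  have hp := C.injective
  have := C.nonempty
  tfae_have 1 → 2 := by
    intro h
    rw [Crystal.Motif.ExponentiallyRigid, (C.firstOrderRigid_iff_complex).mp h]
    exact inf_eq_right.mpr (M.rigidSpace_le_expSpace hp)
  tfae_have 2 → 3 := by
    intro h
    refine ⟨fun ω u hu hper => ?_, Set.Subset.antisymm (fun u hu => ?_) fun u hu =>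
      ⟨C.rigidSpace_le_flexSpace ℂ hu, M.isAffinelyPeriodic_of_mem_rigidSpace hp hu⟩⟩
    · rw [← h]
      exact ⟨M.mem_expSpace_of_factorPeriodic ((M.isFactorPeriodic_iff hp ω u).mp hper), hu⟩
    · obtain ⟨X, hX⟩ := (M.isAffinelyPeriodic_iff hp u).mp hu.2
      rw [← h]
      exact ⟨M.mem_expSpace_of_affine hX, hu.1⟩
  tfae_have 3 → 5 := fun h => M.module_eq_rigidityModule hp h.1 h.2
  tfae_have 5 → 1 := by
    intro h
    rw [C.firstOrderRigid_iff_complex]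
    refine le_antisymm (fun u hu => ?_) (C.rigidSpace_le_flexSpace ℂ)
    refine M.mem_rigidSpace_of_pairing_rigidityModule fun q hq => ?_
    exact (M.mem_flexSpace_iff u).mp hu q (h ▸ hq : q ∈ (M.module : Set _))
  tfae_have 5 ↔ 6 := M.module_eq_rigidityModule_iff_polynomialVectors
  tfae_have 3 → 4 := fun h =>
    ⟨M.transferRankExtremal hp h.1, (M.flexibleLatticeRigid_iff hp).mp h.2⟩
  tfae_have 4 → 3 := fun h =>
    have hflex := (M.flexibleLatticeRigid_iff hp).mpr h.2
    ⟨M.noFactorPeriodicFlex hp h.1 hflex, hflex⟩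
  tfae_finish
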